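/- Let $n$ be a positive integer and $[n]=\{1,\dots,n\}$. An alternating sign matrix (ASM) of size $n$ is an $n\times n$ matrix $A=(a_{ij})$ with entries in $\{-1,0,1\}$ such that all partial row sums $\sum_{k\le j}a_{ik}$ and partial column sums $\sum_{k\le i}a_{kj}$ lie in $\{0,1\}$ and every full row sum and column sum equals $1$. Let $\mathcal A_n$ be the set of all of them. The corner sum matrix of $A$ is $\widetilde A(i,j)=\sum_{p\le i,\,q\le j}a_{pq}$, with $\widetilde A(i,j)=0$ if $i=0$ or $j=0$; it determines $A$. Define the ASM order by $A\le B$ if and only if $\widetilde A(i,j)\ge\widetilde B(i,j)$ for all $i,j\in[n]$, and define $$\beta(A)=\sum_{i,j=1}^n\min(i,j)-\sum_{i,j=1}^n\widetilde A(i,j).$$ For $i<j$ and $k<l$ in $[n]$ let $R_{ij}^{kl}=\{(p,q): i\le p<j,\ k\le q<l\}$, with indicator matrix $\widetilde R_{ij}^{kl}$. The rectangle $R_{ij}^{kl}$ is essential for $A$ if, for all $(p,q)\in R_{ij}^{kl}$, $$\widetilde A(p,k)=\widetilde A(p,k-1),\quad \widetilde A(p,l)=\widetilde A(p,l-1)+1,\quad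 \widetilde A(i,q)=\widetilde A(i-1,q),\quad \widetilde A(j,q)=\widetilde A(j-1,q)+1,$$ and dual essential for $A$ if, for all $(p,q)\in R_{ij}^{kl}$, $$\widetilde A(p,k)=\widetilde A(p,k-1)+1,\quad \widetilde A(p,l)=\widetilde A(p,l-1),\quad \widetilde A(i,q)=\widetilde A(i-1,q)+1,\quad \widetilde A(j,q)=\widetilde A(j-1,q).$$ Let $r_{ij}^{kl}(A)$ be the ASM whose corner sum matrix is $\widetilde A+\widetilde R_{ij}^{kl}$ if $R_{ij}^{kl}$ is essential for $A$, $\widetilde A-\widetilde R_{ij}^{kl}$ if it is dual essential for $A$, and $\widetilde A$ otherwise. Write $A\to B$ if $B=r_{ij}^{kl}(A)$ for some $i<j$ and $k<l$ in $[n]$, and $\beta(A)<\beta(B)$. A permutation $w$ of $[n]$ is bigrassmannian if there is exactly one pair $(i,j)\in[n-1]^2$ with $w^{-1}(i)>w^{-1}(i+1)$ and $w(j)>w(j+1)$; it is identified with the permutation matrix having $a_{ij}=1$ if $j=w(i)$ and $a_{ij}=0$ otherwise. **Proposition.** 1. (Chain Property) If $A,B\in\mathcal A_n$ and $A\le B$,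 then there are $k\ge 0$ and a directed path $A=A_0\to A_1\to\cdots\to A_k=B$ such that $\beta(A_i)-\beta(A_{i-1})=1$ for all $i=1,\dots,k$. 2. For every $A\in\mathcal A_n$, $$\beta(A)=\bigl|\{B\in\mathcal A_n: B\le A \text{ and } B \text{ is bigrassmannian}\}\bigr|.$$ -/

import Mathlib

/-- `A` is an alternating sign matrix: entries in `{-1, 0, 1}`, all partial sums along rows and
columns (from the left, from the top) in `{0, 1}`, and all full row and column sums equal to `1`. -/
structure IsASM {n : ℕ} (A : Matrix (Fin n) (Fin n) ℤ) : Prop where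
  entry : ∀ i j, A i j = -1 ∨ A i j = 0 ∨ A i j = 1
  row_partial : ∀ i j, (∑ k with k ≤ j, A i k) = 0 ∨ (∑ k with k ≤ j, A i k) = 1
  col_partial : ∀ i j, (∑ k with k ≤ i, A k j) = 0 ∨ (∑ k with k ≤ i, A k j) = 1
  row_sum : ∀ i, ∑ k, A i k = 1
  col_sum : ∀ j, ∑ k, A k j = 1

/-- The set of alternating sign matrices of size `n`. -/
@[ext]
structure ASM (n : ℕ) where
  mat : Matrix (Fin n) (Fin n) ℤ
  isASM : IsASM mat

namespace ASM

/-- There are only finitely many alternating sign matrices of size `n`. -/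
instance instFinite (n : ℕ) : Finite (ASM n) := by
  let f : ASM n → (Fin n → Fin n → Set.Icc (-1 : ℤ) 1) := fun A i j =>
    ⟨A.mat i j, by
      rcases A.isASM.entry i j with h | h | h <;> rw [h] <;> constructor <;> norm_num⟩
  refine Finite.of_injective f fun A B h => ?_
  ext i j
  exact congrArg Subtype.val (congrFun (congrFun h i) j)

/-- The corner sum `Ã(i, j) = ∑_{p ≤ i, q ≤ j} a_{pq}`, with positions `i`, `j` counted from `1`
(the row of index `p : Fin n` is row number `p + 1`). It is `0` if `i = 0` or `j = 0`. -/
def cornerSum {n : ℕ} (A : ASM n) (i j : ℕ) : ℤ :=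
  ∑ p : Fin n, ∑ q : Fin n, if (p : ℕ) + 1 ≤ i ∧ (q : ℕ) + 1 ≤ j then A.mat p q else 0

/-- ASM order: `A ≤ B` iff `Ã(i, j) ≥ B̃(i, j)` for all positions `(i, j)`. -/
instance instLE (n : ℕ) : LE (ASM n) where
  le A B := ∀ i ∈ Finset.Icc 1 n, ∀ j ∈ Finset.Icc 1 n, B.cornerSum i j ≤ A.cornerSum i j

/-- The statistic `β(A) = ∑_{i,j} min(i, j) - ∑_{i,j} Ã(i, j)`. -/
def beta {n : ℕ} (A : ASM n) : ℤ :=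
  (∑ i ∈ Finset.Icc 1 n, ∑ j ∈ Finset.Icc 1 n, ((min i j : ℕ) : ℤ)) -
    ∑ i ∈ Finset.Icc 1 n, ∑ j ∈ Finset.Icc 1 n, A.cornerSum i j

/-- The rectangle `R_{ij}^{kl}` of positions `(p, q)` with `i ≤ p < j` and `k ≤ q < l`. -/
def rect (i j k l : ℕ) : Finset (ℕ × ℕ) := Finset.Ico i j ×ˢ Finset.Ico k l

/-- `R_{ij}^{kl}` is an essential rectangle for `A`. -/
def IsEssential {n : ℕ} (A : ASM n) (i j k l : ℕ) : Prop :=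
  ∀ p q : ℕ, (p, q) ∈ rect i j k l →
    A.cornerSum p k = A.cornerSum p (k - 1) ∧
    A.cornerSum p l = A.cornerSum p (l - 1) + 1 ∧
    A.cornerSum i q = A.cornerSum (i - 1) q ∧
    A.cornerSum j q = A.cornerSum (j - 1) q + 1

/-- `R_{ij}^{kl}` is a dual essential rectangle for `A`. -/
def IsDualEssential {n : ℕ} (A : ASM n) (i j k l : ℕ) : Prop :=
  ∀ p q : ℕ, (p, q) ∈ rect i j k l →
    A.cornerSum p k = A.cornerSum p (k - 1) + 1 ∧
    A.cornerSum p l = A.cornerSum p (l - 1) ∧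
    A.cornerSum i q = A.cornerSum (i - 1) q + 1 ∧
    A.cornerSum j q = A.cornerSum (j - 1) q

open Classical in
/-- The `(p, q)` entry of the matrix obtained by applying the rectangular operator of
`R_{ij}^{kl}` to the corner sum matrix of `A`: add the indicator of the rectangle if it is essential
for `A`, subtract it if it is dual essential, and change nothing otherwise. -/
noncomputable def rectCornerSum {n : ℕ} (A : ASM n) (i j k l p q : ℕ) : ℤ :=
  if A.IsEssential i j k l then
    A.cornerSum p q + (if (p, q) ∈ rect i j k l then 1 else 0)
  else if A.IsDualEssential i j k l then
    A.cornerSum p q - (if (p, q) ∈ rect i j k l then 1 else 0)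
  else A.cornerSum p q

/-- `B = r_{ij}^{kl}(A)`: `B` is the alternating sign matrix whose corner sum matrix is the one
given by the rectangular operator. -/
def IsRectImage {n : ℕ} (i j k l : ℕ) (A B : ASM n) : Prop :=
  ∀ p ∈ Finset.Icc 1 n, ∀ q ∈ Finset.Icc 1 n, B.cornerSum p q = A.rectCornerSum i j k l p q

/-- The edge relation `A → B` of the ASM graph: `B = r_{ij}^{kl}(A)` for some `i < j`, `k < l` in
`{1, …, n}`, and `β(A) < β(B)`. -/
def Edge {n : ℕ} (A B : ASM n) : Prop :=
  ∃ i ∈ Finset.Icc 1 n, ∃ j ∈ Finset.Icc 1 n, ∃ k ∈ Finset.Icc 1 n, ∃ l ∈ Finset.Icc 1 n,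
    i < j ∧ k < l ∧ IsRectImage i j k l A B ∧ A.beta < B.beta

end ASM

/-- A permutation `w` is bigrassmannian if there is a unique pair `(i, j)` of positions in
`{1, …, n - 1}` with `w⁻¹(i) > w⁻¹(i + 1)` and `w(j) > w(j + 1)` (here counted from `0`). -/
def IsBigrassmannianPerm {n : ℕ} (w : Equiv.Perm (Fin n)) : Prop :=
  ∃! x : Fin (n - 1) × Fin (n - 1),
    w⁻¹ ⟨x.1 + 1, by omega⟩ < w⁻¹ ⟨x.1, by omega⟩ ∧ w ⟨x.2 + 1, by omega⟩ < w ⟨x.2, by omega⟩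

/-- `A` is the permutation matrix (`a_{ij} = 1` iff `j = w(i)`) of a bigrassmannian `w`. -/
def ASM.IsBigrassmannian {n : ℕ} (A : ASM n) : Prop :=
  ∃ w : Equiv.Perm (Fin n), (∀ i j, A.mat i j = if j = w i then 1 else 0) ∧ IsBigrassmannianPerm w

/-! Corner sum matrices of ASMs are exactly the functions with the forced boundary values and steps
in {0, 1} (`isCornerFn`, `toASM`), so both claims become statements about such functions.

Chain property: if A < B, take a position with Ã > B̃ that minimizes the height i + j - 2Ã. A lower
neighbour would have Ã = B̃, which contradicts the step condition for B̃. The position is thus a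
local minimum, where Ã can drop by one: this is a dual essential 1×1 rectangle, and the result stays
below B. Induct on β(B) - β(A).

Counting: β(A) is the number of triples (i, j, r) with Ã(i, j) ≤ r < min(i, j). A bigrassmannian
with descent i, inverse descent j and corner sum r there has corner sums min(p, q, r + (p-i)⁺ +
(q-j)⁺), because rows and columns are concave away from the descents (`eq_min`). By the Lipschitz
bound this is the largest corner function with value at most r at (i, j), so B ≤ A iff Ã(i, j) ≤ r.
Block swaps realize all admissible triples. -/

/-- The conditions that characterize the corner sum matrices of alternating sign matrices of
size `n`, for a function on positions `0 ≤ i, j ≤ n`. -/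
structure IsCornerFn (n : ℕ) (f : ℕ → ℕ → ℤ) : Prop where
  zero_left : ∀ j ≤ n, f 0 j = 0
  zero_right : ∀ i ≤ n, f i 0 = 0
  top_left : ∀ j ≤ n, f n j = j
  top_right : ∀ i ≤ n, f i n = i
  step_left : ∀ i < n, ∀ j ≤ n, f (i + 1) j = f i j ∨ f (i + 1) j = f i j + 1
  step_right : ∀ i ≤ n, ∀ j < n, f i (j + 1) = f i j ∨ f i (j + 1) = f i j + 1

/-- A sum of consecutive differences over `Fin n`, cut off at `j`, telescopes. -/
theorem Fin.sum_ite_sub (n : ℕ) (g : ℕ → ℤ) {j : ℕ} (hj : j ≤ n) :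
    (∑ q : Fin n, if (q : ℕ) + 1 ≤ j then g (q + 1) - g q else 0) = g j - g 0 := by
  rw [Fin.sum_univ_eq_sum_range (fun q => if q + 1 ≤ j then g (q + 1) - g q else 0) n,
    ← Finset.sum_filter, ← Finset.sum_range_sub]
  refine Finset.sum_congr ?_ fun _ _ => rfl
  ext q
  simp only [Finset.mem_filter, Finset.mem_range]
  omega

/-! ### Alternating sign matrices versus corner functions -/

namespace ASM

variable {n : ℕ}

/-- The transpose of an alternating sign matrix. -/
def transpose (A : ASM n) : ASM n where
  mat := A.mat.transpose
  isASM :=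
    { entry := fun i j => A.isASM.entry j i
      row_partial := fun i j => A.isASM.col_partial j i
      col_partial := fun i j => A.isASM.row_partial j i
      row_sum := A.isASM.col_sum
      col_sum := A.isASM.row_sum }

theorem cornerSum_transpose (A : ASM n) (i j : ℕ) :
    A.transpose.cornerSum i j = A.cornerSum j i := by
  unfold cornerSum
  rw [Finset.sum_comm]
  refine Finset.sum_congr rfl fun p _ => Finset.sum_congr rfl fun q _ => ?_
  simp [transpose, and_comm]

theorem cornerSum_zero_left (A : ASM n) (j : ℕ) : A.cornerSum 0 j = 0 := by
  simp [cornerSum]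

theorem cornerSum_zero_right (A : ASM n) (i : ℕ) : A.cornerSum i 0 = 0 := by
  simp [cornerSum]

/-- Consecutive rows of the corner sum matrix differ by a partial row sum. -/
theorem cornerSum_succ_left (A : ASM n) (i : Fin n) (j : ℕ) :
    A.cornerSum (i + 1) j =
      A.cornerSum i j + ∑ q : Fin n, if (q : ℕ) + 1 ≤ j then A.mat i q else 0 := by
  have h : (∑ q : Fin n, if (q : ℕ) + 1 ≤ j then A.mat i q else 0) =
      ∑ p : Fin n, if p = i then ∑ q : Fin n, (if (q : ℕ) + 1 ≤ j then A.mat p q else 0)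
        else 0 := by simp
  rw [h, cornerSum, cornerSum, ← Finset.sum_add_distrib]
  refine Finset.sum_congr rfl fun p _ => ?_
  by_cases hp : p = i
  · subst hp
    simp
  · have hp' : (p : ℕ) ≠ i := fun h => hp (Fin.ext h)
    simp only [hp, if_false, add_zero]
    refine Finset.sum_congr rfl fun q _ => ?_
    have : ((p : ℕ) + 1 ≤ i + 1 ∧ (q : ℕ) + 1 ≤ j) ↔ ((p : ℕ) + 1 ≤ i ∧ (q : ℕ) + 1 ≤ j) := by
      omega
    simp only [this]

/-- Consecutive columns of the corner sum matrix differ by a partial column sum. -/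
theorem cornerSum_succ_right (A : ASM n) (i : ℕ) (j : Fin n) :
    A.cornerSum i (j + 1) =
      A.cornerSum i j + ∑ p : Fin n, if (p : ℕ) + 1 ≤ i then A.mat p j else 0 := by
  have := A.transpose.cornerSum_succ_left j i
  simp only [cornerSum_transpose] at this
  exact this

theorem cornerSum_step_left (A : ASM n) {i : ℕ} (hi : i < n) {j : ℕ} (hj : j ≤ n) :
    A.cornerSum (i + 1) j = A.cornerSum i j ∨ A.cornerSum (i + 1) j = A.cornerSum i j + 1 := by
  have h := A.cornerSum_succ_left ⟨i, hi⟩ j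
  simp only at h
  rw [h]
  -- Cutting off at j + 1 gives the partial row sum up to index j; a cutoff of 0 gives the empty
  -- sum.
  rcases j with _ | j
  · simp
  · have := A.isASM.row_partial ⟨i, hi⟩ ⟨j, hj⟩
    simp only [Finset.sum_filter, Fin.le_def] at this
    simp only [Nat.add_le_add_iff_right]
    omega

theorem cornerSum_step_right (A : ASM n) {i : ℕ} (hi : i ≤ n) {j : ℕ} (hj : j < n) :
    A.cornerSum i (j + 1) = A.cornerSum i j ∨ A.cornerSum i (j + 1) = A.cornerSum i j + 1 := by
  simpa only [cornerSum_transpose] using A.transpose.cornerSum_step_left hj hi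

theorem cornerSum_top_right (A : ASM n) {i : ℕ} (hi : i ≤ n) : A.cornerSum i n = i := by
  induction i with
  | zero => simp [cornerSum_zero_left]
  | succ i ih =>
    have h := A.cornerSum_succ_left ⟨i, hi⟩ n
    have h' : ∀ q : Fin n, (q : ℕ) + 1 ≤ n := fun q => q.2
    simp only [h', if_true, A.isASM.row_sum, ih (by omega)] at h
    rw [h]
    push_cast
    rfl

theorem cornerSum_top_left (A : ASM n) {j : ℕ} (hj : j ≤ n) : A.cornerSum n j = j := by
  simpa only [cornerSum_transpose] using A.transpose.cornerSum_top_right hj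

theorem isCornerFn (A : ASM n) : IsCornerFn n A.cornerSum where
  zero_left j _ := A.cornerSum_zero_left j
  zero_right i _ := A.cornerSum_zero_right i
  top_left _ hj := A.cornerSum_top_left hj
  top_right _ hi := A.cornerSum_top_right hi
  step_left _ hi _ hj := A.cornerSum_step_left hi hj
  step_right _ hi _ hj := A.cornerSum_step_right hi hj

/-- The entries of an alternating sign matrix in terms of its corner sums. -/
theorem mat_eq (A : ASM n) (p q : Fin n) :
    A.mat p q = A.cornerSum (p + 1) (q + 1) - A.cornerSum p (q + 1) -
      (A.cornerSum (p + 1) q - A.cornerSum p q) := by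
  rw [A.cornerSum_succ_left p, A.cornerSum_succ_left p, add_sub_cancel_left,
    add_sub_cancel_left, ← Finset.sum_sub_distrib]
  rw [Finset.sum_eq_single q]
  · simp
  · intro b _ hb
    have hb' : (b : ℕ) ≠ q := fun h => hb (Fin.ext h)
    have : (b : ℕ) + 1 ≤ q + 1 ↔ (b : ℕ) + 1 ≤ q := by omega
    simp only [this, sub_self]
  · simp

/-- The corner sum matrix determines the alternating sign matrix. -/
theorem ext_cornerSum {A B : ASM n}
    (h : ∀ i ≤ n, ∀ j ≤ n, A.cornerSum i j = B.cornerSum i j) : A = B := by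
  ext p q
  have hp := p.2
  have hq := q.2
  rw [A.mat_eq, B.mat_eq, h _ (by omega) _ (by omega), h _ (by omega) _ (by omega),
    h _ (by omega) _ (by omega), h _ (by omega) _ (by omega)]

end ASM

namespace IsCornerFn

variable {n : ℕ} {f : ℕ → ℕ → ℤ}

theorem swap (hf : IsCornerFn n f) : IsCornerFn n fun i j => f j i where
  zero_left := hf.zero_right
  zero_right := hf.zero_left
  top_left := hf.top_right
  top_right := hf.top_left
  step_left i hi j hj := hf.step_right j hj i hi
  step_right i hi j hj := hf.step_left j hj i hi

theorem sum_row (hf : IsCornerFn n f) (i : ℕ) (hi : i < n) (j : ℕ) (hj : j ≤ n) :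
    (∑ q : Fin n, if (q : ℕ) + 1 ≤ j then
      f (i + 1) (q + 1) - f i (q + 1) - (f (i + 1) q - f i q) else 0) = f (i + 1) j - f i j := by
  rw [Fin.sum_ite_sub n (fun q => f (i + 1) q - f i q) hj, hf.zero_right _ hi,
    hf.zero_right _ hi.le]
  simp

theorem row_partial (hf : IsCornerFn n f) (i j : Fin n) :
    (∑ q : Fin n with q ≤ j,
      (f (i + 1) (q + 1) - f i (q + 1) - (f (i + 1) q - f i q))) = 0 ∨
    (∑ q : Fin n with q ≤ j,
      (f (i + 1) (q + 1) - f i (q + 1) - (f (i + 1) q - f i q))) = 1 := by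
  have h := hf.sum_row i i.2 (j + 1) j.2
  simp only [Nat.add_le_add_iff_right] at h
  simp only [Finset.sum_filter, Fin.le_def]
  rw [h]
  have := hf.step_left i i.2 (j + 1) j.2
  omega

theorem row_sum (hf : IsCornerFn n f) (i : Fin n) :
    ∑ q : Fin n, (f (i + 1) (q + 1) - f i (q + 1) - (f (i + 1) q - f i q)) = 1 := by
  have h := hf.sum_row i i.2 n le_rfl
  have h' : ∀ q : Fin n, (q : ℕ) + 1 ≤ n := fun q => q.2
  simp only [h', if_true] at h
  rw [h, hf.top_right _ i.2, hf.top_right _ i.2.le]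
  push_cast
  ring

/-- The alternating sign matrix with a prescribed corner sum matrix. -/
def toASM (hf : IsCornerFn n f) : ASM n where
  mat := fun i j => f (i + 1) (j + 1) - f i (j + 1) - (f (i + 1) j - f i j)
  isASM :=
    { entry := fun i j => by
        have h₁ := hf.step_left i i.2 j j.2.le
        have h₂ := hf.step_left i i.2 (j + 1) j.2
        omega
      row_partial := hf.row_partial
      col_partial := fun i j => by
        simpa only [sub_sub_sub_comm] using hf.swap.row_partial j i
      row_sum := hf.row_sum
      col_sum := fun j => by
        simpa only [sub_sub_sub_comm] using hf.swap.row_sum j }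

theorem cornerSum_toASM (hf : IsCornerFn n f) {i j : ℕ} (hi : i ≤ n) (hj : j ≤ n) :
    hf.toASM.cornerSum i j = f i j := by
  induction i with
  | zero => rw [ASM.cornerSum_zero_left, hf.zero_left _ hj]
  | succ i ih =>
    have h := hf.toASM.cornerSum_succ_left ⟨i, hi⟩ j
    have h' := hf.sum_row i hi j hj
    simp only [toASM] at h
    rw [h'] at h
    have := ih (by omega)
    simp only [toASM] at this ⊢
    omega

/-! ### Lipschitz bounds -/

/-- A corner function grows by at most one in each step down a column. -/
theorem add_left_le (hf : IsCornerFn n f) (i d j : ℕ) (hi : i + d ≤ n) (hj : j ≤ n) :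
    f i j ≤ f (i + d) j ∧ f (i + d) j ≤ f i j + d := by
  induction d with
  | zero => simp
  | succ d ih =>
    have h₁ := ih (by omega)
    have h₂ := hf.step_left (i + d) (by omega) j hj
    push_cast
    rw [← add_assoc]
    omega

theorem sub_le_left (hf : IsCornerFn n f) {i p j : ℕ} (hi : i ≤ n) (hp : p ≤ n) (hj : j ≤ n) :
    f p j ≤ f i j + ((p - i : ℕ) : ℤ) := by
  rcases le_total i p with h | h
  · obtain ⟨d, rfl⟩ := Nat.exists_eq_add_of_le h
    have := hf.add_left_le i d j hp hj
    rw [Nat.add_sub_cancel_left]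
    exact this.2
  · obtain ⟨d, rfl⟩ := Nat.exists_eq_add_of_le h
    have := hf.add_left_le p d j hi hj
    omega

/-- The Lipschitz bound for corner functions. -/
theorem le_add (hf : IsCornerFn n f) {i j p q : ℕ} (hi : i ≤ n) (hj : j ≤ n) (hp : p ≤ n)
    (hq : q ≤ n) : f p q ≤ f i j + ((p - i : ℕ) : ℤ) + ((q - j : ℕ) : ℤ) := by
  have h₁ := hf.sub_le_left hi hp hq
  have h₂ := hf.swap.sub_le_left hj hq hi
  omega

theorem le_min (hf : IsCornerFn n f) {p q : ℕ} (hp : p ≤ n) (hq : q ≤ n) :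
    f p q ≤ min p q := by
  have h₁ := hf.le_add (zero_le (a := n)) hq hp hq
  have h₂ := hf.le_add hp (zero_le (a := n)) hp hq
  rw [hf.zero_left _ hq] at h₁
  rw [hf.zero_right _ hp] at h₂
  simp only [Nat.sub_zero, Nat.sub_self] at h₁ h₂
  push_cast at *
  omega

theorem nonneg (hf : IsCornerFn n f) {p q : ℕ} (hp : p ≤ n) (hq : q ≤ n) : 0 ≤ f p q := by
  have := hf.le_add hp hq (zero_le (a := n)) hq
  rw [hf.zero_left _ hq] at this
  omega

/-- Climbing from row n, where the value is q, loses at most one per row. -/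
theorem add_sub_le (hf : IsCornerFn n f) {p q : ℕ} (hp : p ≤ n) (hq : q ≤ n) :
    (p : ℤ) + q - n ≤ f p q := by
  have := hf.sub_le_left hp le_rfl hq
  rw [hf.top_left _ hq] at this
  omega

end IsCornerFn

/-! ### The chain property -/

namespace ASM

variable {n : ℕ}

theorem cornerSum_le_of_le {A B : ASM n} (h : A ≤ B) {i j : ℕ} (hi : i ≤ n) (hj : j ≤ n) :
    B.cornerSum i j ≤ A.cornerSum i j := by
  rcases Nat.eq_zero_or_pos i with rfl | hi'
  · rw [cornerSum_zero_left, cornerSum_zero_left]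
  rcases Nat.eq_zero_or_pos j with rfl | hj'
  · rw [cornerSum_zero_right, cornerSum_zero_right]
  exact h i (Finset.mem_Icc.2 ⟨hi', hi⟩) j (Finset.mem_Icc.2 ⟨hj', hj⟩)

theorem beta_le_of_le {A B : ASM n} (h : A ≤ B) : A.beta ≤ B.beta :=
  sub_le_sub_left (Finset.sum_le_sum fun i hi => Finset.sum_le_sum fun j hj => h i hi j hj) _

/-- If `A < B`, some position where `Ã > B̃` is a local minimum of the height function
`i + j - 2 Ã(i, j)`. -/
theorem exists_local_min {A B : ASM n} (h : A ≤ B) (hne : A ≠ B) :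
    ∃ i j, i + 1 < n ∧ j + 1 < n ∧
      B.cornerSum (i + 1) (j + 1) < A.cornerSum (i + 1) (j + 1) ∧
      A.cornerSum (i + 1) (j + 1) = A.cornerSum i (j + 1) + 1 ∧
      A.cornerSum (i + 1) (j + 1) = A.cornerSum (i + 1) j + 1 ∧
      A.cornerSum (i + 2) (j + 1) = A.cornerSum (i + 1) (j + 1) ∧
      A.cornerSum (i + 1) (j + 2) = A.cornerSum (i + 1) (j + 1) := by
  classical
  let S := (Finset.range (n + 1) ×ˢ Finset.range (n + 1)).filter fun x =>
    B.cornerSum x.1 x.2 < A.cornerSum x.1 x.2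
  have hS : S.Nonempty := by
    by_contra hS
    rw [Finset.not_nonempty_iff_eq_empty, Finset.filter_eq_empty_iff] at hS
    refine hne (ext_cornerSum fun i hi j hj => le_antisymm ?_ (cornerSum_le_of_le h hi hj))
    exact not_lt.1 (hS (x := (i, j))
      (Finset.mem_product.2 ⟨Finset.mem_range.2 (by omega), Finset.mem_range.2 (by omega)⟩))
  obtain ⟨⟨p, q⟩, hx, hmin⟩ := Finset.exists_min_image S
    (fun x => (x.1 : ℤ) + x.2 - 2 * A.cornerSum x.1 x.2) hS
  have hmem : ∀ i j, (i, j) ∈ S ↔ (i ≤ n ∧ j ≤ n) ∧ B.cornerSum i j < A.cornerSum i j := by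
    intro i j
    simp only [S, Finset.mem_filter, Finset.mem_product, Finset.mem_range, Nat.lt_succ_iff]
  obtain ⟨⟨hp, hq⟩, hlt⟩ := (hmem p q).1 hx
  -- By minimality, a position of smaller height lies outside `S`.
  have key : ∀ i j, i ≤ n → j ≤ n →
      (i : ℤ) + j - 2 * A.cornerSum i j < p + q - 2 * A.cornerSum p q →
      A.cornerSum i j = B.cornerSum i j := by
    intro i j hi hj hij
    by_contra hc
    have := hmin (i, j) ((hmem i j).2 ⟨⟨hi, hj⟩,
      lt_of_le_of_ne (cornerSum_le_of_le h hi hj) (Ne.symm hc)⟩)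
    simp only at this
    omega
  have hA := A.isCornerFn
  have hB := B.isCornerFn
  -- Boundary values are the same for A and B, so the minimizer is interior.
  have hp0 : p ≠ 0 := by
    rintro rfl
    rw [hA.zero_left _ hq, hB.zero_left _ hq] at hlt
    omega
  have hq0 : q ≠ 0 := by
    rintro rfl
    rw [hA.zero_right _ hp, hB.zero_right _ hp] at hlt
    omega
  have hpn : p ≠ n := by
    rintro rfl
    rw [hA.top_left _ hq, hB.top_left _ hq] at hlt
    omega
  have hqn : q ≠ n := by
    rintro rfl
    rw [hA.top_right _ hp, hB.top_right _ hp] at hlt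
    omega
  obtain ⟨i, rfl⟩ := Nat.exists_eq_succ_of_ne_zero hp0
  obtain ⟨j, rfl⟩ := Nat.exists_eq_succ_of_ne_zero hq0
  simp only [Nat.succ_eq_add_one] at *
  refine ⟨i, j, by omega, by omega, hlt, ?_, ?_, ?_, ?_⟩
  · have a := hA.step_left i (by omega) (j + 1) hq
    have b := hB.step_left i (by omega) (j + 1) hq
    have k := key i (j + 1) (by omega) hq
    push_cast at k
    omega
  · have a := hA.step_right (i + 1) hp j (by omega)
    have b := hB.step_right (i + 1) hp j (by omega)
    have k := key (i + 1) j hp (by omega)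
    push_cast at k
    omega
  · have a := hA.step_left (i + 1) (by omega) (j + 1) hq
    have b := hB.step_left (i + 1) (by omega) (j + 1) hq
    have k := key (i + 1 + 1) (j + 1) (by omega) hq
    push_cast at k
    simp only [show i + 2 = i + 1 + 1 from rfl]
    omega
  · have a := hA.step_right (i + 1) hp (j + 1) (by omega)
    have b := hB.step_right (i + 1) hp (j + 1) (by omega)
    have k := key (i + 1) (j + 1 + 1) hp (by omega)
    push_cast at k
    simp only [show j + 2 = j + 1 + 1 from rfl]
    omega

/-- Lowering a corner sum matrix by one at a local minimum of the height function. -/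
theorem isCornerFn_sub_single (A : ASM n) {i j : ℕ} (hi : i + 1 < n) (hj : j + 1 < n)
    (h₁ : A.cornerSum (i + 1) (j + 1) = A.cornerSum i (j + 1) + 1)
    (h₂ : A.cornerSum (i + 1) (j + 1) = A.cornerSum (i + 1) j + 1)
    (h₃ : A.cornerSum (i + 2) (j + 1) = A.cornerSum (i + 1) (j + 1))
    (h₄ : A.cornerSum (i + 1) (j + 2) = A.cornerSum (i + 1) (j + 1)) :
    IsCornerFn n fun p q => A.cornerSum p q - if p = i + 1 ∧ q = j + 1 then 1 else 0 where
  zero_left q _ := by simp [cornerSum_zero_left]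
  zero_right p _ := by simp [cornerSum_zero_right]
  top_left q hq := by rw [if_neg (by omega), sub_zero, A.cornerSum_top_left hq]
  top_right p hp := by rw [if_neg (by omega), sub_zero, A.cornerSum_top_right hp]
  step_left p hp q hq := by
    have h := A.cornerSum_step_left hp hq
    by_cases hq' : q = j + 1
    · subst hq'
      by_cases hp₁ : p = i
      · subst hp₁
        simp only [and_true, if_true, if_neg (show ¬ p = p + 1 by omega)]
        omega
      · by_cases hp₂ : p = i + 1
        · subst hp₂
          simp only [and_true, if_true, if_neg (show ¬ i + 1 + 1 = i + 1 by omega)]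
          simp only [Nat.add_assoc, Nat.reduceAdd] at h ⊢
          omega
        · rw [if_neg (by omega), if_neg (by omega)]
          omega
    · rw [if_neg (by omega), if_neg (by omega)]
      omega
  step_right p hp q hq := by
    have h := A.cornerSum_step_right hp hq
    by_cases hp' : p = i + 1
    · subst hp'
      by_cases hq₁ : q = j
      · subst hq₁
        simp only [true_and, if_true, if_neg (show ¬ q = q + 1 by omega)]
        omega
      · by_cases hq₂ : q = j + 1
        · subst hq₂
          simp only [true_and, if_true, if_neg (show ¬ j + 1 + 1 = j + 1 by omega)]
          simp only [Nat.add_assoc, Nat.reduceAdd] at h ⊢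
          omega
        · rw [if_neg (by omega), if_neg (by omega)]
          omega
    · rw [if_neg (by omega), if_neg (by omega)]
      omega

/-- If `A < B` there is an edge from `A` to some `C ≤ B` that raises `β` by one. -/
theorem exists_edge {A B : ASM n} (h : A ≤ B) (hne : A ≠ B) :
    ∃ C : ASM n, Edge A C ∧ C.beta = A.beta + 1 ∧ C ≤ B := by
  obtain ⟨i, j, hi, hj, hlt, h₁, h₂, h₃, h₄⟩ := exists_local_min h hne
  let hf := A.isCornerFn_sub_single hi hj h₁ h₂ h₃ h₄
  have hC : ∀ p ∈ Finset.Icc 1 n, ∀ q ∈ Finset.Icc 1 n, hf.toASM.cornerSum p q =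
      A.cornerSum p q - if p = i + 1 ∧ q = j + 1 then 1 else 0 := fun p hp q hq =>
    hf.cornerSum_toASM (Finset.mem_Icc.1 hp).2 (Finset.mem_Icc.1 hq).2
  have hi' : i + 1 ∈ Finset.Icc 1 n := Finset.mem_Icc.2 ⟨by omega, by omega⟩
  have hj' : j + 1 ∈ Finset.Icc 1 n := Finset.mem_Icc.2 ⟨by omega, by omega⟩
  have hbeta : hf.toASM.beta = A.beta + 1 := by
    have : ∑ p ∈ Finset.Icc 1 n, ∑ q ∈ Finset.Icc 1 n, hf.toASM.cornerSum p q =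
        (∑ p ∈ Finset.Icc 1 n, ∑ q ∈ Finset.Icc 1 n, A.cornerSum p q) - 1 := by
      rw [Finset.sum_congr rfl fun p hp => Finset.sum_congr rfl fun q hq => hC p hp q hq]
      simp only [Finset.sum_sub_distrib, ite_and]
      congr 1
      rw [Finset.sum_eq_single_of_mem _ hi' (fun b _ hb => by simp [hb])]
      simp only [if_true]
      rw [Finset.sum_ite_eq' , if_pos hj']
    unfold beta
    rw [this]
    ring
  have hdual : A.IsDualEssential (i + 1) (i + 2) (j + 1) (j + 2) := by
    intro p q hpq
    simp only [rect, Finset.mem_product, Finset.mem_Ico] at hpq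
    obtain rfl : p = i + 1 := by omega
    obtain rfl : q = j + 1 := by omega
    exact ⟨h₂, h₄, h₁, h₃⟩
  -- `rectCornerSum` tests essentiality first, so it has to be excluded.
  have hess : ¬ A.IsEssential (i + 1) (i + 2) (j + 1) (j + 2) := by
    intro he
    have := (he (i + 1) (j + 1) (by simp [rect])).1
    simp only [Nat.add_sub_cancel] at this
    omega
  refine ⟨hf.toASM, ⟨i + 1, hi', i + 2, Finset.mem_Icc.2 ⟨by omega, by omega⟩, j + 1, hj', j + 2,
    Finset.mem_Icc.2 ⟨by omega, by omega⟩, by omega, by omega, ?_, by omega⟩, hbeta, ?_⟩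
  · intro p hp q hq
    rw [hC p hp q hq, rectCornerSum, if_neg hess, if_pos hdual]
    congr 1
    refine if_congr ?_ rfl rfl
    simp only [rect, Finset.mem_product, Finset.mem_Ico]
    omega
  · intro p hp q hq
    rw [hC p hp q hq]
    have := h p hp q hq
    split_ifs with hpq
    · obtain ⟨rfl, rfl⟩ := hpq
      omega
    · omega

/-- The chain property. -/
theorem exists_chain {A B : ASM n} (h : A ≤ B) :
    ∃ (k : ℕ) (P : Fin (k + 1) → ASM n), P 0 = A ∧ P (Fin.last k) = B ∧
      ∀ i : Fin k, Edge (P i.castSucc) (P i.succ) ∧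
        (P i.succ).beta - (P i.castSucc).beta = 1 := by
  obtain ⟨m, hm⟩ : ∃ m : ℕ, B.beta - A.beta = m :=
    ⟨_, (Int.toNat_of_nonneg (sub_nonneg.2 (beta_le_of_le h))).symm⟩
  induction m generalizing A with
  | zero =>
    -- With equal β, an edge towards B would overshoot β(B).
    by_cases hne : A = B
    · exact ⟨0, fun _ => A, rfl, hne, fun i => i.elim0⟩
    · obtain ⟨C, -, hC, hCB⟩ := exists_edge h hne
      have := beta_le_of_le hCB
      push_cast at hm
      omega
  | succ m ih =>
    have hne : A ≠ B := by
      rintro rfl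
      push_cast at hm
      omega
    obtain ⟨C, hedge, hC, hCB⟩ := exists_edge h hne
    obtain ⟨k, P, h0, hl, hP⟩ := ih hCB (by push_cast at hm; omega)
    refine ⟨k + 1, Fin.cons A P, rfl, ?_, ?_⟩
    · rw [← Fin.succ_last, Fin.cons_succ, hl]
    · intro i
      refine Fin.cases ?_ (fun i => ?_) i
      · rw [Fin.castSucc_zero, Fin.cons_zero, Fin.cons_succ, h0]
        exact ⟨hedge, by omega⟩
      · rw [Fin.castSucc_succ, Fin.cons_succ, Fin.cons_succ]
        exact hP i

end ASM

/-! ### Concavity and the closed form -/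

/-- A sequence with steps in `{0, 1}` that stays constant once it stops growing. -/
theorem eq_min_of_concave {h : ℕ → ℤ} {m : ℕ}
    (step : ∀ d < m, h (d + 1) = h d ∨ h (d + 1) = h d + 1)
    (conc : ∀ d, d + 1 < m → h (d + 1) = h d → h (d + 2) = h (d + 1)) {d : ℕ} (hd : d ≤ m) :
    h d = min (h 0 + d) (h m) := by
  have mono : ∀ e, d + e ≤ m → h d ≤ h (d + e) := by
    intro e he
    induction e with
    | zero => simp
    | succ e ih =>
      have h₁ := ih (by omega)
      have h₂ := step (d + e) (by omega)
      rw [← add_assoc]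
      omega
  have hmd := mono (m - d) (by omega)
  rw [Nat.add_sub_cancel' hd] at hmd
  -- Either every step so far is a rise, or the last step is flat; in the second case concavity
  -- keeps the sequence flat up to m.
  have first : ∀ e ≤ m, h e = h 0 + e ∨ h e < h 0 + e ∧ ∃ c, e = c + 1 ∧ h (c + 1) = h c := by
    intro e he
    induction e with
    | zero => simp
    | succ e ih =>
      have h₂ := step e (by omega)
      rcases ih (by omega) with h₁ | ⟨h₁, c, rfl, hc⟩
      · rcases h₂ with h₂ | h₂
        · exact Or.inr ⟨by omega, e, rfl, h₂⟩
        · left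
          omega
      · have := conc c (by omega) hc
        exact Or.inr ⟨by simp only [Nat.add_assoc] at *; omega, c + 1, rfl, this⟩
  rcases first d hd with h₁ | ⟨h₁, c, rfl, hc⟩
  · omega
  · have const : ∀ e, c + 1 + e ≤ m → h (c + 1 + e) = h (c + e) ∧ h (c + 1 + e) = h (c + 1) := by
      intro e he
      induction e with
      | zero => exact ⟨hc, rfl⟩
      | succ e ih =>
        obtain ⟨i₁, i₂⟩ := ih (by omega)
        have := conc (c + e) (by omega) (by rw [← i₁]; congr 1; omega)
        rw [show c + 1 + (e + 1) = c + e + 2 by omega, show c + (e + 1) = c + e + 1 by omega]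
        refine ⟨this, ?_⟩
        rw [this, ← i₂]
        congr 1
        omega
    have := (const (m - (c + 1)) (by omega)).2
    rw [Nat.add_sub_cancel' hd] at this
    omega

namespace IsCornerFn

variable {n : ℕ} {f : ℕ → ℕ → ℤ}

/-- A column of a corner function that is concave except at row `i`. -/
theorem eq_min_left (hf : IsCornerFn n f) {i q : ℕ} (hi : i ≤ n) (hq : q ≤ n)
    (conc : ∀ p, p + 1 < n → p + 1 ≠ i → f (p + 1) q = f p q → f (p + 2) q = f (p + 1) q)
    {p : ℕ} (hp : p ≤ n) :
    f p q = min (min (p : ℤ) q) (f i q + ((p - i : ℕ) : ℤ)) := by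
  have hz := hf.zero_left q hq
  have ht := hf.top_left q hq
  have hm := hf.le_min hi hq
  rcases le_total p i with h | h
  · have := eq_min_of_concave (h := fun p => f p q) (m := i)
      (fun d hd => hf.step_left d (by omega) q hq)
      (fun d hd => conc d (by omega) (by omega)) h
    push_cast at hm
    omega
  · have := eq_min_of_concave (h := fun d => f (i + d) q) (m := n - i)
      (fun d hd => hf.step_left (i + d) (by omega) q hq)
      (fun d hd => conc (i + d) (by omega) (by omega)) (d := p - i) (by omega)
    simp only [add_zero, Nat.add_sub_cancel' h, Nat.add_sub_cancel' hi] at this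
    push_cast at hm
    omega

/-- A corner function that is concave in both directions except at row `i` and column `j`. -/
theorem eq_min (hf : IsCornerFn n f) {i j : ℕ} (hi : i ≤ n) (hj : j ≤ n)
    (conc_left : ∀ q ≤ n, ∀ p, p + 1 < n → p + 1 ≠ i →
      f (p + 1) q = f p q → f (p + 2) q = f (p + 1) q)
    (conc_right : ∀ p ≤ n, ∀ q, q + 1 < n → q + 1 ≠ j →
      f p (q + 1) = f p q → f p (q + 2) = f p (q + 1))
    {p q : ℕ} (hp : p ≤ n) (hq : q ≤ n) :
    f p q = min (min (p : ℤ) q) (f i j + ((p - i : ℕ) : ℤ) + ((q - j : ℕ) : ℤ)) := by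
  -- Go along column q to row i, then along row i to column j.
  have h₁ := hf.eq_min_left hi hq (conc_left q hq) hp
  have h₂ := hf.swap.eq_min_left hj hi (conc_right i hi) hq
  omega

end IsCornerFn

/-! ### Corner sums of bigrassmannian permutations -/

namespace ASM

variable {n : ℕ}

/-- The alternating sign matrix of a permutation. -/
def ofPerm (w : Equiv.Perm (Fin n)) : ASM n where
  mat := fun i j => if j = w i then 1 else 0
  isASM :=
    { entry := fun i j => by split_ifs <;> simp
      row_partial := fun i j => by
        rw [Finset.sum_ite_eq']
        split_ifs <;> simp
      col_partial := fun i j => by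
        simp only [← Equiv.symm_apply_eq (e := w)]
        rw [Finset.sum_ite_eq]
        split_ifs <;> simp
      row_sum := fun i => by simp
      col_sum := fun j => by simp [← Equiv.symm_apply_eq (e := w)] }

theorem cornerSum_perm_succ_left {A : ASM n} {w : Equiv.Perm (Fin n)}
    (hw : ∀ i j, A.mat i j = if j = w i then 1 else 0) {i : ℕ} (hi : i < n) (j : ℕ) :
    A.cornerSum (i + 1) j = A.cornerSum i j + if (w ⟨i, hi⟩ : ℕ) < j then 1 else 0 := by
  refine (A.cornerSum_succ_left ⟨i, hi⟩ j).trans (congrArg _ ?_)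
  rw [Finset.sum_eq_single (w ⟨i, hi⟩)]
  · rw [hw, if_pos rfl]
    rfl
  · intro b _ hb
    rw [hw, if_neg hb, ite_self]
  · exact fun h => absurd (Finset.mem_univ _) h

theorem cornerSum_perm_succ_right {A : ASM n} {w : Equiv.Perm (Fin n)}
    (hw : ∀ i j, A.mat i j = if j = w i then 1 else 0) (i : ℕ) {j : ℕ} (hj : j < n) :
    A.cornerSum i (j + 1) = A.cornerSum i j + if (w⁻¹ ⟨j, hj⟩ : Fin n) < i then 1 else 0 := by
  have := cornerSum_perm_succ_left (A := A.transpose) (w := w⁻¹) (fun i j => by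
    change A.mat j i = _
    rw [hw]
    exact if_congr (by rw [Equiv.Perm.eq_inv_iff_eq, eq_comm]) rfl rfl) hj i
  simp only [cornerSum_transpose] at this
  exact this

/-- The corner sum matrix of a bigrassmannian permutation. -/
theorem cornerSum_bigrassmannian {A : ASM n} {w : Equiv.Perm (Fin n)}
    (hw : ∀ i j, A.mat i j = if j = w i then 1 else 0) {x : Fin (n - 1) × Fin (n - 1)}
    (hx : w⁻¹ ⟨x.1 + 1, by omega⟩ < w⁻¹ ⟨x.1, by omega⟩ ∧ w ⟨x.2 + 1, by omega⟩ < w ⟨x.2, by omega⟩)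
    (huniq : ∀ y : Fin (n - 1) × Fin (n - 1),
      w⁻¹ ⟨y.1 + 1, by omega⟩ < w⁻¹ ⟨y.1, by omega⟩ ∧ w ⟨y.2 + 1, by omega⟩ < w ⟨y.2, by omega⟩ →
        y = x)
    {p q : ℕ} (hp : p ≤ n) (hq : q ≤ n) :
    A.cornerSum p q = min (min (p : ℤ) q) (A.cornerSum (x.2 + 1) (x.1 + 1) +
      ((p - (x.2 + 1) : ℕ) : ℤ) + ((q - (x.1 + 1) : ℕ) : ℤ)) := by
  have h₁ := x.1.2
  have h₂ := x.2.2
  refine A.isCornerFn.eq_min (by omega) (by omega) ?_ ?_ hp hq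
  · intro q hq p hp hpx h
    -- Another descent of w, paired with the inverse descent `x.1`, would give a second pair. A flat
    -- step means q ≤ w(p), hence q ≤ w(p + 1), and the next step is flat too.
    have hle : w ⟨p, by omega⟩ ≤ w ⟨p + 1, hp⟩ := by
      by_contra hlt
      have := huniq (x.1, ⟨p, by omega⟩) ⟨hx.1, not_le.1 hlt⟩
      exact hpx (by rw [← this])
    have s₁ := cornerSum_perm_succ_left hw (show p < n by omega) q
    have s₂ := cornerSum_perm_succ_left hw hp q
    rw [Fin.le_def] at hle
    split_ifs at s₁ s₂ <;> simp only [Nat.add_assoc, Nat.reduceAdd] at * <;> omega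
  · intro p hp q hq hqx h
    have hle : w⁻¹ ⟨q, by omega⟩ ≤ w⁻¹ ⟨q + 1, hq⟩ := by
      by_contra hlt
      have := huniq (⟨q, by omega⟩, x.2) ⟨not_le.1 hlt, hx.2⟩
      exact hqx (by rw [← this])
    have s₁ := cornerSum_perm_succ_right hw p (show q < n by omega)
    have s₂ := cornerSum_perm_succ_right hw p hq
    rw [Fin.le_def] at hle
    split_ifs at s₁ s₂ <;> simp only [Nat.add_assoc, Nat.reduceAdd] at * <;> omega

/-- At the descents of a bigrassmannian permutation, the corner sum is not the maximal one. -/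
theorem cornerSum_bigrassmannian_lt {A : ASM n} {w : Equiv.Perm (Fin n)}
    (hw : ∀ i j, A.mat i j = if j = w i then 1 else 0) {x : Fin (n - 1) × Fin (n - 1)}
    (hx : w⁻¹ ⟨x.1 + 1, by omega⟩ < w⁻¹ ⟨x.1, by omega⟩ ∧ w ⟨x.2 + 1, by omega⟩ < w ⟨x.2, by omega⟩)
    (huniq : ∀ y : Fin (n - 1) × Fin (n - 1),
      w⁻¹ ⟨y.1 + 1, by omega⟩ < w⁻¹ ⟨y.1, by omega⟩ ∧ w ⟨y.2 + 1, by omega⟩ < w ⟨y.2, by omega⟩ →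
        y = x) :
    A.cornerSum (x.2 + 1) (x.1 + 1) < min (x.2 + 1 : ℕ) (x.1 + 1 : ℕ) := by
  have h₁ := x.1.2
  have h₂ := x.2.2
  have hle := A.isCornerFn.le_min (p := x.2 + 1) (q := x.1 + 1) (by omega) (by omega)
  by_contra hge
  -- Equality would make A the identity. At the descent, the column cutoff w(`x.2`) gives a flat
  -- step followed by a rise, which min(p, q) never has.
  have hid : ∀ p ≤ n, ∀ q ≤ n, A.cornerSum p q = min (p : ℤ) q := by
    intro p hp q hq
    have := cornerSum_bigrassmannian hw hx huniq hp hq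
    push_cast at *
    omega
  have hlt := hx.2
  rw [Fin.lt_def] at hlt
  have hq := (w ⟨x.2, by omega⟩).2
  have s₁ := cornerSum_perm_succ_left hw (show (x.2 : ℕ) < n by omega) (w ⟨x.2, by omega⟩)
  have s₂ := cornerSum_perm_succ_left hw (show (x.2 : ℕ) + 1 < n by omega) (w ⟨x.2, by omega⟩)
  rw [if_neg (lt_irrefl _), hid _ (by omega) _ hq.le, hid _ (by omega) _ hq.le] at s₁
  rw [if_pos hlt, hid _ (by omega) _ hq.le, hid _ (by omega) _ hq.le] at s₂
  push_cast at s₁ s₂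
  omega

/-- Comparison with a matrix whose corner sums are the largest possible ones with value at most
`r` at `(i, j)`. -/
theorem le_iff_cornerSum_le {A B : ASM n} {i j : ℕ} (hi : i ≤ n) (hj : j ≤ n)
    (hB : ∀ p ≤ n, ∀ q ≤ n, B.cornerSum p q = min (min (p : ℤ) q)
      (B.cornerSum i j + ((p - i : ℕ) : ℤ) + ((q - j : ℕ) : ℤ))) :
    B ≤ A ↔ A.cornerSum i j ≤ B.cornerSum i j := by
  refine ⟨fun h => cornerSum_le_of_le h hi hj, fun h p hp q hq => ?_⟩
  have hp := (Finset.mem_Icc.1 hp).2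
  have hq := (Finset.mem_Icc.1 hq).2
  -- These two bounds hold for every ASM, and B attains their minimum.
  have h₁ := A.isCornerFn.le_min hp hq
  have h₂ := A.isCornerFn.le_add hi hj hp hq
  rw [hB p hp q hq]
  push_cast at h₁
  omega

end ASM

/-! ### Block swaps as the bigrassmannian permutations -/

/-- The permutation that fixes the first `r` positions, exchanges the block of positions
`r, …, i - 1` with the block of the following `j - r` positions, and fixes the rest. -/
def blockSwap {n i j r : ℕ} (h : r < i ∧ r < j ∧ i + j ≤ n + r) : Equiv.Perm (Fin n) where
  toFun p := ⟨if (p : ℕ) < r then p else if (p : ℕ) < i then p + (j - r)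
    else if (p : ℕ) < i + j - r then p - (i - r) else p, by split_ifs <;> omega⟩
  invFun p := ⟨if (p : ℕ) < r then p else if (p : ℕ) < j then p + (i - r)
    else if (p : ℕ) < i + j - r then p - (j - r) else p, by split_ifs <;> omega⟩
  left_inv p := by
    ext
    simp only
    split_ifs <;> omega
  right_inv p := by
    ext
    simp only
    split_ifs <;> omega

theorem blockSwap_inv {n i j r : ℕ} (h : r < i ∧ r < j ∧ i + j ≤ n + r) :
    (blockSwap h)⁻¹ = blockSwap (n := n) (i := j) (j := i) (r := r)
    ⟨h.2.1, h.1, by omega⟩ := by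
  ext p
  change ((blockSwap h).invFun p : ℕ) = _
  simp only [blockSwap, Equiv.coe_fn_mk, add_comm j i]

/-- The map increases on each block; the only drop is where the two exchanged, nonempty blocks meet.
-/
theorem blockSwap_succ_lt {n i j r : ℕ} (h : r < i ∧ r < j ∧ i + j ≤ n + r)
    {p : ℕ} (hp : p + 1 < n) :
    blockSwap h ⟨p + 1, hp⟩ < blockSwap h ⟨p, by omega⟩ ↔ p + 1 = i := by
  simp only [blockSwap, Equiv.coe_fn_mk, Fin.lt_def]
  split_ifs <;> omega

/-- The only descents of `blockSwap h` and its inverse (counted from `1`) are at `i` and `j`. -/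
theorem blockSwap_descent_iff {n i j r : ℕ} (h : r < i ∧ r < j ∧ i + j ≤ n + r)
    (y : Fin (n - 1) × Fin (n - 1)) :
    ((blockSwap h)⁻¹ ⟨y.1 + 1, by omega⟩ < (blockSwap h)⁻¹ ⟨y.1, by omega⟩ ∧
      blockSwap h ⟨y.2 + 1, by omega⟩ < blockSwap h ⟨y.2, by omega⟩) ↔
      y = (⟨j - 1, by omega⟩, ⟨i - 1, by omega⟩) := by
  rw [blockSwap_inv, blockSwap_succ_lt, blockSwap_succ_lt, Prod.ext_iff, Fin.ext_iff, Fin.ext_iff]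
  simp only
  omega

namespace ASM

variable {n : ℕ}

theorem isBigrassmannian_blockSwap {i j r : ℕ} (h : r < i ∧ r < j ∧ i + j ≤ n + r) :
    (ofPerm (blockSwap (n := n) h)).IsBigrassmannian :=
  ⟨blockSwap h, fun _ _ => rfl, (⟨j - 1, by omega⟩, ⟨i - 1, by omega⟩),
    (blockSwap_descent_iff h _).2 rfl, fun y hy => (blockSwap_descent_iff h y).1 hy⟩

theorem cornerSum_blockSwap {i j r : ℕ} (h : r < i ∧ r < j ∧ i + j ≤ n + r) :
    (ofPerm (blockSwap (n := n) h)).cornerSum i j = r := by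
  -- Among the first i positions, only the r fixed ones have values below j.
  have key : ∀ p ≤ i, (ofPerm (blockSwap (n := n) h)).cornerSum p j = min p r := by
    intro p hp
    induction p with
    | zero => simp [cornerSum_zero_left]
    | succ p ih =>
      rw [cornerSum_perm_succ_left (w := blockSwap h) (fun _ _ => rfl) (by omega), ih (by omega)]
      simp only [blockSwap, Equiv.coe_fn_mk]
      push_cast
      split_ifs <;> omega
  rw [key i le_rfl]
  omega

theorem cornerSum_blockSwap_eq {i j r : ℕ} (h : r < i ∧ r < j ∧ i + j ≤ n + r) {p q : ℕ}
    (hp : p ≤ n) (hq : q ≤ n) :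
    (ofPerm (blockSwap (n := n) h)).cornerSum p q =
      min (min (p : ℤ) q) (r + ((p - i : ℕ) : ℤ) + ((q - j : ℕ) : ℤ)) := by
  have := cornerSum_bigrassmannian (A := ofPerm (blockSwap (n := n) h)) (fun _ _ => rfl)
    ((blockSwap_descent_iff h _).2 rfl) (fun y hy => (blockSwap_descent_iff h y).1 hy) hp hq
  simp only [show i - 1 + 1 = i by omega, show j - 1 + 1 = j by omega,
    cornerSum_blockSwap h] at this
  exact this

theorem blockSwap_le_iff {i j r : ℕ} (h : r < i ∧ r < j ∧ i + j ≤ n + r) (A : ASM n) :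
    ofPerm (blockSwap (n := n) h) ≤ A ↔ A.cornerSum i j ≤ r := by
  rw [le_iff_cornerSum_le (i := i) (j := j) (by omega) (by omega), cornerSum_blockSwap h]
  intro p hp q hq
  rw [cornerSum_blockSwap_eq h hp hq, cornerSum_blockSwap h]

theorem ofPerm_injective : Function.Injective (ofPerm (n := n)) := by
  intro v w h
  ext i
  have := congrFun (congrFun (congrArg ASM.mat h) i) (v i)
  simp only [ofPerm, if_true] at this
  rw [eq_comm, ite_eq_left_iff] at this
  by_contra hc
  exact absurd (this fun h => hc (congrArg _ h)) (by norm_num)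

/-- The descents recover i and j, and the corner sum there recovers r. -/
theorem blockSwap_injective {i j r i' j' r' : ℕ} (h : r < i ∧ r < j ∧ i + j ≤ n + r)
    (h' : r' < i' ∧ r' < j' ∧ i' + j' ≤ n + r')
    (heq : ofPerm (blockSwap (n := n) h) = ofPerm (blockSwap h')) : i = i' ∧ j = j' ∧ r = r' := by
  have hd := (blockSwap_descent_iff (n := n) h (⟨j - 1, by omega⟩, ⟨i - 1, by omega⟩)).2 rfl
  rw [ofPerm_injective heq, blockSwap_descent_iff h', Prod.ext_iff, Fin.ext_iff, Fin.ext_iff] at hd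
  simp only at hd
  obtain rfl : i = i' := by omega
  obtain rfl : j = j' := by omega
  have := cornerSum_blockSwap (n := n) h
  rw [heq, cornerSum_blockSwap h'] at this
  exact ⟨rfl, rfl, by omega⟩

/-- The corner sum at the descents determines the whole matrix; its strict upper bound and
`add_sub_le` make the triple admissible. -/
theorem IsBigrassmannian.exists_blockSwap {A : ASM n} (hA : A.IsBigrassmannian) :
    ∃ (i j r : ℕ) (h : r < i ∧ r < j ∧ i + j ≤ n + r), ofPerm (blockSwap (n := n) h) = A := by
  obtain ⟨w, hw, x, hx, huniq⟩ := hA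
  have hlt := cornerSum_bigrassmannian_lt hw hx huniq
  have h₁ := x.1.2
  have h₂ := x.2.2
  have hge := A.isCornerFn.add_sub_le (p := x.2 + 1) (q := x.1 + 1) (by omega) (by omega)
  obtain ⟨r, hr⟩ := Int.eq_ofNat_of_zero_le
    (A.isCornerFn.nonneg (p := x.2 + 1) (q := x.1 + 1) (by omega) (by omega))
  refine ⟨x.2 + 1, x.1 + 1, r, by push_cast at *; omega, ext_cornerSum fun p hp q hq => ?_⟩
  rw [cornerSum_blockSwap_eq _ hp hq, cornerSum_bigrassmannian hw hx huniq hp hq, hr]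

/-! ### Counting triples -/

/-- The positions `(i, j)` and values `r` with `Ã(i, j) ≤ r < min(i, j)`. -/
def triples (A : ASM n) : Finset (Σ _ : ℕ × ℕ, ℕ) :=
  (Finset.Icc 1 n ×ˢ Finset.Icc 1 n).sigma fun x =>
    Finset.Ico (A.cornerSum x.1 x.2).toNat (min x.1 x.2)

theorem mem_triples {A : ASM n} {t : Σ _ : ℕ × ℕ, ℕ} :
    t ∈ A.triples ↔ ((1 ≤ t.1.1 ∧ t.1.1 ≤ n) ∧ 1 ≤ t.1.2 ∧ t.1.2 ≤ n) ∧
      A.cornerSum t.1.1 t.1.2 ≤ t.2 ∧ t.2 < t.1.1 ∧ t.2 < t.1.2 := by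
  simp only [triples, Finset.mem_sigma, Finset.mem_product, Finset.mem_Icc, Finset.mem_Ico,
    Int.toNat_le, lt_min_iff]

/-- Since 0 ≤ Ã ≤ min(i, j), neither `toNat` nor natural subtraction truncates. -/
theorem card_triples (A : ASM n) : (A.triples.card : ℤ) = A.beta := by
  rw [triples, Finset.card_sigma, Finset.sum_product, beta, ← Finset.sum_sub_distrib]
  push_cast
  refine Finset.sum_congr rfl fun i hi => ?_
  rw [← Finset.sum_sub_distrib]
  refine Finset.sum_congr rfl fun j hj => ?_
  have hi := (Finset.mem_Icc.1 hi).2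
  have hj := (Finset.mem_Icc.1 hj).2
  have h₁ := A.isCornerFn.le_min hi hj
  have h₂ := A.isCornerFn.nonneg hi hj
  rw [Nat.card_Ico]
  push_cast at *
  omega

theorem triples_spec {A : ASM n} {t : Σ _ : ℕ × ℕ, ℕ} (ht : t ∈ A.triples) :
    t.2 < t.1.1 ∧ t.2 < t.1.2 ∧ t.1.1 + t.1.2 ≤ n + t.2 := by
  obtain ⟨⟨⟨_, h₁⟩, _, h₂⟩, h₃, h₄, h₅⟩ := mem_triples.1 ht
  have := A.isCornerFn.add_sub_le h₁ h₂
  omega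

/-- The statistic `β` counts the bigrassmannian permutations below `A`. -/
theorem beta_eq_ncard (A : ASM n) :
    A.beta = ({B : ASM n | B ≤ A ∧ B.IsBigrassmannian}.ncard : ℤ) := by
  rw [← card_triples, ← Set.ncard_coe_finset, Nat.cast_inj]
  refine Set.ncard_congr (fun t ht => ofPerm (blockSwap (triples_spec (Finset.mem_coe.1 ht))))
    ?_ ?_ ?_
  · intro t ht
    exact ⟨(blockSwap_le_iff _ A).2 (mem_triples.1 ht).2.1, isBigrassmannian_blockSwap _⟩
  · rintro ⟨⟨i, j⟩, r⟩ ⟨⟨i', j'⟩, r'⟩ ht ht' heq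
    obtain ⟨h₁, h₂, h₃⟩ := blockSwap_injective _ _ heq
    simp only at h₁ h₂ h₃
    rw [h₁, h₂, h₃]
  · rintro B ⟨hle, hB⟩
    obtain ⟨i, j, r, h, rfl⟩ := hB.exists_blockSwap
    have hij : (1 ≤ i ∧ i ≤ n) ∧ 1 ≤ j ∧ j ≤ n := by omega
    exact ⟨⟨(i, j), r⟩, Finset.mem_coe.2
      (mem_triples.2 ⟨hij, (blockSwap_le_iff h A).1 hle, h.1, h.2.1⟩), rfl⟩

end ASM

theorem mainTheorem6 (n : ℕ) :
    (∀ A B : ASM n, A ≤ B →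
      ∃ (k : ℕ) (P : Fin (k + 1) → ASM n), P 0 = A ∧ P (Fin.last k) = B ∧
        ∀ i : Fin k, ASM.Edge (P i.castSucc) (P i.succ) ∧
          (P i.succ).beta - (P i.castSucc).beta = 1) ∧
    (∀ A : ASM n,
      A.beta = ({B : ASM n | B ≤ A ∧ B.IsBigrassmannian}.ncard : ℤ)) :=
  ⟨fun _ _ h => ASM.exists_chain h, ASM.beta_eq_ncard⟩
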